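/- **Setting.** Let $0<\alpha\le\frac12$ (maximal overflow probability), $s_{\max}\in(0,1]$, $s_{\min}\in(0,s_{\max})$, $p_{\max}\in(0,1)$. For integers $k\ge 1$ and $\lambda\ge 0$ let $Q(k,\lambda)=\mathbb P(\mathrm{Poi}(\lambda)\le k-1)=\sum_{j=0}^{k-1}e^{-\lambda}\lambda^j/j!$, and let $Q^{-1}(k,\gamma)$, for $0<\gamma\le 1$, be the unique $\lambda\ge 0$ with $Q(k,\lambda)=\gamma$. Items $X_1,\dots,X_n$ are independent random variables, $X_i$ taking the value $s_i$ with probability $p_i$ and $0$ with probability $1-p_i$, where $p_i\in(0,1]$ and $0<s_i\le s_{\max}$. An assignment of the items to bins is *viable* if $\mathbb P(\sum_{i\in\mathcal B}X_i>1)\le\alpha$ for each bin $\mathcal B$; let $OPT$ be the least number of bins of a viable assignment. **Algorithm RPAP.** Put $k_{\min}=\lfloor 1/s_{\max}\rfloor$, $k_{\max}=\lceil 1/s_{\min}\rceil-1$, $\lambda_k=Q^{-1}(k+1,1-\alpha)$ and $\mu_0=\dfrac{2\alpha+s_{\min}-\sqrt{s_{\min}^2+4\alpha s_{\min}}}{2\alpha}$.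 Item $i$ is *confident* if $p_i>p_{\max}$; *minor* if $p_i\le p_{\max}$ and $s_i\le s_{\min}$; otherwise it is *standard of subgroup $k=\lfloor 1/s_i\rfloor\in\{k_{\min},\dots,k_{\max}\}$*. Its packing size is $s_i$, $p_is_i/\mu_0$ or $\log(1/(1-p_i))/\lambda_k$, respectively. Items are processed online in the order $1,\dots,n$. Each of the $k_{\max}-k_{\min}+3$ (sub)groups (confident, minor, each standard subgroup) has its own bins of size $1$ and is packed by an arbitrary Any-Fit algorithm using the packing sizes: an item is put into some open bin of its (sub)group in which it fits, and a new bin is opened for it only if it fits in no open bin of its (sub)group. **Theorem.** Let $$\lambda_{\min}=\frac{Q^{-1}(\lfloor 1/s_{\max}\rfloor+1,\,1-\alpha)}{\lfloor 1/s_{\max}\rfloor+1},\qquad \mu_{\min}=\tfrac12\min\bigl(p_{\max},\ \mu_0,\ (1-p_{\max})\lambda_{\min}\bigr),\qquad C=\frac{1+\alpha}{(1-\alpha)\,\mu_{\min}}.$$ Suppose that RPAP packs the items into $M$ bins in total. Then: 1. For every non-empty collection of (sub)groups each of which received at least two bins, the average over all bins of the collection of the expected load $\sum_{i\in\mathcal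 B}p_is_i$ is at least $\mu_{\min}$. 2. $M\le C\cdot OPT+k_{\max}-k_{\min}+3$. 3. (Optimized parameters.) We have $0<\frac{\lambda_{\min}}{1+\lambda_{\min}}<1$, and for all admissible $p_{\max},s_{\min}$ $$C\ \ge\ 2\,\frac{1+\alpha}{1-\alpha}\cdot\frac{1+\lambda_{\min}}{\lambda_{\min}},$$ with equality if $p_{\max}=\frac{\lambda_{\min}}{1+\lambda_{\min}}$ and $s_{\min}\le\frac{\alpha(1-p_{\max})^2}{p_{\max}}$. In particular, for $s_{\max}=1$ and such $p_{\max},s_{\min}$, $$C=2\,\frac{1+\alpha}{1-\alpha}\Bigl(1+\frac{2}{Q^{-1}(2,1-\alpha)}\Bigr).$$ -/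

import Mathlib

/-!
Stochastic bin packing of independent scaled Bernoulli items, and the online algorithm
"Refined Poisson Approximation Packing" (RPAP).
-/

namespace StochPack

/-- `poissonQ k x` is the probability that a Poisson variable of mean `x` is less than `k`,
i.e. at most `k - 1`. It equals the regularized upper incomplete gamma function
`Γ(k, x) / Γ(k)`, so that `poissonQ (⌊t⌋₊ + 1) x` is the Poisson CDF at `t ≥ 0`. -/
noncomputable def poissonQ (k : ℕ) (x : NNReal) : ℝ :=
  (ProbabilityTheory.poissonMeasure x).real (Set.Iio k)

/-- The inverse of `poissonQ` with respect to its second argument. For `k ≥ 1` the map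
`poissonQ k` is a strictly decreasing bijection from `[0, ∞)` onto `(0, 1]`, so for
`0 < γ ≤ 1` this is the unique `x ≥ 0` with `poissonQ k x = γ`. -/
noncomputable def poissonQInv (k : ℕ) (γ : ℝ) : ℝ :=
  ((Function.invFun (poissonQ k) γ : NNReal) : ℝ)

/-! ### Viable packings -/

/-- The assignment `f` of items to `m` bins of capacity `1` is viable: in each bin the
probability of overflow is at most `α`. -/
def IsViable {Ω : Type*} [MeasurableSpace Ω] {n m : ℕ} (P : MeasureTheory.Measure Ω)
    (X : Fin n → Ω → ℝ) (α : ℝ) (f : Fin n → Fin m) : Prop :=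
  ∀ j : Fin m, P.real {ω | 1 < ∑ i with f i = j, X i ω} ≤ α

/-- `OPT` is the least number of bins of a viable assignment of all items. -/
def IsOptimalBinCount {Ω : Type*} [MeasurableSpace Ω] {n : ℕ} (P : MeasureTheory.Measure Ω)
    (X : Fin n → Ω → ℝ) (α : ℝ) (OPT : ℕ) : Prop :=
  IsLeast {m : ℕ | ∃ f : Fin n → Fin m, IsViable P X α f} OPT

/-! ### Any-Fit packing into bins of size 1 -/

/-- An item `i` fits in the bin with content `b` when items are measured by `w`. -/
def Fits {ι : Type*} (w : ι → ℝ) (i : ι) (b : List ι) : Prop :=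
  (b.map w).sum + w i ≤ 1

/-- One step of an arbitrary Any-Fit algorithm: `PackAnyFit w i bins bins'` says that from the
list `bins` of open bins the item `i` may be packed so that `bins'` results. The item goes to
some open bin in which it fits; a new bin is opened only if it fits in no open bin. -/
inductive PackAnyFit {ι : Type*} (w : ι → ℝ) (i : ι) :
    List (List ι) → List (List ι) → Prop
  | intoOpen (pre : List (List ι)) (b : List ι) (post : List (List ι)) (h : Fits w i b) :
      PackAnyFit w i (pre ++ b :: post) (pre ++ (i :: b) :: post)
  | newBin (bins : List (List ι)) (h : ∀ b ∈ bins, ¬ Fits w i b) :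
      PackAnyFit w i bins (bins ++ [[i]])

/-! ### The algorithm RPAP -/

/-- The groups of items; each has its own set of bins. -/
inductive Group where
  | confident : Group
  | minor : Group
  | standard (k : ℕ) : Group
  deriving DecidableEq

/-- `k_min = ⌊1 / s_max⌋`. -/
noncomputable def kMin (smax : ℝ) : ℕ := ⌊1 / smax⌋₊

/-- `k_max = ⌈1 / s_min⌉ - 1` (the ceiling is at least `1` for `s_min > 0`). -/
noncomputable def kMax (smin : ℝ) : ℕ := ⌈1 / smin⌉₊ - 1

/-- `λ_k = Q⁻¹(k + 1, 1 - α)`. -/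
noncomputable def lam (α : ℝ) (k : ℕ) : ℝ := poissonQInv (k + 1) (1 - α)

/-- The scaling factor for minor items. -/
noncomputable def muZero (α smin : ℝ) : ℝ :=
  (2 * α + smin - √(smin ^ 2 + 4 * α * smin)) / (2 * α)

/-- The group of an item with probability `p` and size `s`. -/
noncomputable def groupOf (smin pmax p s : ℝ) : Group :=
  open Classical in
  if pmax < p then Group.confident
  else if s ≤ smin then Group.minor
  else Group.standard ⌊1 / s⌋₊

/-- The value by which an item with probability `p` and size `s` is packed in group `g`. -/
noncomputable def packSize (α smin p s : ℝ) : Group → ℝ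
  | Group.confident => s
  | Group.minor => p * s / muZero α smin
  | Group.standard k => Real.log (1 / (1 - p)) / lam α k

/-- `RPAPRun α smin pmax p s l st`: after RPAP has processed online the items of the list `l`,
in this order, the bins of each group may be those given by `st`. The choice among the open
bins in which an item fits is left to the Any-Fit algorithm in use. -/
inductive RPAPRun {ι : Type*} (α smin pmax : ℝ) (p s : ι → ℝ) :
    List ι → (Group → List (List ι)) → Prop
  | start : RPAPRun α smin pmax p s [] (fun _ => [])
  | step (l : List ι) (st : Group → List (List ι)) (i : ι) (g : Group) (bins : List (List ι))
      (hrun : RPAPRun α smin pmax p s l st)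
      (hg : g = groupOf smin pmax (p i) (s i))
      (hpack : PackAnyFit (fun i' => packSize α smin (p i') (s i') g) i (st g) bins) :
      RPAPRun α smin pmax p s (l ++ [i]) (Function.update st g bins)

/-- The number of bins that RPAP returns: those of the confident items, of the minor items, and
of the standard items of the subgroups `k_min, …, k_max`. -/
noncomputable def binCount {ι : Type*} (smax smin : ℝ) (st : Group → List (List ι)) : ℕ :=
  (st Group.confident).length + (st Group.minor).length +
    ∑ k ∈ Finset.Icc (kMin smax) (kMax smin), (st (Group.standard k)).length

/-- The average expected value of all bins in the groups of the finite set `G`. -/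
noncomputable def avgExpected {ι : Type*} (p s : ι → ℝ) (st : Group → List (List ι))
    (G : Finset Group) : ℝ :=
  (∑ g ∈ G, ((st g).map fun b => (b.map fun i => p i * s i).sum).sum) /
    ((∑ g ∈ G, (st g).length : ℕ) : ℝ)

/-! ### The constants -/

/-- `λ_min = Q⁻¹(⌊1 / s_max⌋ + 1, 1 - α) / (⌊1 / s_max⌋ + 1)`. -/
noncomputable def lamMin (α smax : ℝ) : ℝ :=
  poissonQInv (⌊1 / smax⌋₊ + 1) (1 - α) / ((⌊1 / smax⌋₊ : ℝ) + 1)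

/-- `μ_min = ½ min (p_max, μ₀, (1 - p_max) λ_min)`. -/
noncomputable def muMin (α smax smin pmax : ℝ) : ℝ :=
  1 / 2 * min pmax (min (muZero α smin) ((1 - pmax) * lamMin α smax))

/-- The approximation constant `C = (1 + α) / ((1 - α) μ_min)`. -/
noncomputable def approxConst (α smax smin pmax : ℝ) : ℝ :=
  (1 + α) / ((1 - α) * muMin α smax smin pmax)

end StochPack

namespace StochPack

/-! ### The Poisson distribution function and its inverse -/

/-! The expected load `∑ p * s` is compared across the two packings. A viable bin has expected load
at most `(1 + α) / (1 - α)` (`sum_integral_le`), so all items together have load at most `OPT` times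
this. Conversely, any two bins of an Any-Fit group have joint packing size above `1`, so a group
with at least two bins has average packing size at least `1 / 2` (`length_le_two_mul_sum`). Each
item's load is at least `2 * muMin` times its packing size (`two_mul_muMin_mul_packSize_le`), hence
such bins carry at least `muMin` on average. Groups with at most one bin only cost the additive
term.

The delicate ratio is that of standard items, which needs `λ_k / (k + 1)` to be nondecreasing in `k`
(`monotone_poissonQInv_div`). This follows from the growth in `k` of `P(Poi((k + 1) t) ≤ k)` for
fixed `t ≤ 1`. The restriction `t ≤ 1` is met because `α ≤ 1 / 2` and a Poisson variable of integral
mean `m ≥ 1` has median at least `m`. -/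

/-- The sum of the first `k` Poisson weights, as a function of a real mean. -/
noncomputable def poissonSum (k : ℕ) (x : ℝ) : ℝ :=
  ∑ j ∈ Finset.range k, Real.exp (-x) * x ^ j / j.factorial

lemma poissonQ_eq_poissonSum (k : ℕ) (x : NNReal) : poissonQ k x = poissonSum k x := by
  have h : (Set.Iio k : Set ℕ) = ↑(Finset.range k) := by ext; simp
  rw [poissonQ, h, ← MeasureTheory.sum_measureReal_singleton]
  simp [poissonSum, ProbabilityTheory.poissonMeasure_real_singleton]

/-- The derivative of the `j`-th weight is the weight at `j - 1` minus the weight at `j`; the sum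
telescopes. -/
lemma hasDerivAt_poissonSum_succ (k : ℕ) (x : ℝ) :
    HasDerivAt (poissonSum (k + 1)) (-(Real.exp (-x) * x ^ k / k.factorial)) x := by
  induction k with
  | zero =>
    have h : poissonSum 1 = fun x => Real.exp (-x) := by ext; simp [poissonSum]
    rw [h]
    simpa using (hasDerivAt_neg x).exp
  | succ k ih =>
    have h : poissonSum (k + 1 + 1) = fun x => poissonSum (k + 1) x +
        Real.exp (-x) * x ^ (k + 1) / (k + 1).factorial := by
      ext x; rw [poissonSum, Finset.sum_range_succ, poissonSum]
    rw [h]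
    have h2 := ((hasDerivAt_neg x).exp.mul (hasDerivAt_pow (k + 1) x)).div_const
      ((k + 1).factorial : ℝ)
    refine (ih.add h2).congr_deriv ?_
    have : (k.factorial : ℝ) ≠ 0 := by positivity
    rw [Nat.factorial_succ]
    push_cast
    have : (k : ℝ) + 1 ≠ 0 := by positivity
    field_simp
    ring

lemma continuous_poissonSum_succ (k : ℕ) : Continuous (poissonSum (k + 1)) :=
  continuous_iff_continuousAt.2 fun x => (hasDerivAt_poissonSum_succ k x).continuousAt

lemma strictAntiOn_poissonSum_succ (k : ℕ) :
    StrictAntiOn (poissonSum (k + 1)) (Set.Ici 0) := by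
  refine strictAntiOn_of_deriv_neg (convex_Ici 0) (continuous_poissonSum_succ k).continuousOn
    fun x hx => ?_
  rw [interior_Ici] at hx
  have hx : 0 < x := hx
  rw [(hasDerivAt_poissonSum_succ k x).deriv]
  have : 0 < Real.exp (-x) * x ^ k / k.factorial := by positivity
  linarith

lemma poissonSum_succ_zero (k : ℕ) : poissonSum (k + 1) 0 = 1 := by
  simp [poissonSum, Finset.sum_range_succ']

/-- Poisson weights of mean `m` are at least as large to the right of `m` as at the mirror
points to the left of it. -/
lemma pow_div_factorial_le (m i : ℕ) (hi : i < m) :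
    (m : ℝ) ^ (m - 1 - i) / (m - 1 - i).factorial ≤ (m : ℝ) ^ (m + i) / (m + i).factorial := by
  induction i with
  | zero =>
    -- The weights at `m - 1` and `m` coincide.
    obtain ⟨k, rfl⟩ : ∃ k, m = k + 1 := ⟨m - 1, by omega⟩
    simp only [Nat.add_sub_cancel, Nat.sub_zero, add_zero]
    rw [Nat.factorial_succ, pow_succ]
    have : (k.factorial : ℝ) ≠ 0 := by positivity
    have : (k : ℝ) + 1 ≠ 0 := by positivity
    push_cast
    apply le_of_eq
    field_simp
  | succ i ih =>
    have ih := ih (by omega)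
    obtain ⟨r, rfl⟩ : ∃ r, m = r + i + 2 := ⟨m - i - 2, by omega⟩
    have e1 : r + i + 2 - 1 - i = r + 1 := by omega
    have e2 : r + i + 2 - 1 - (i + 1) = r := by omega
    rw [e1] at ih
    rw [e2, ← add_assoc, Nat.factorial_succ, pow_succ]
    rw [Nat.factorial_succ, pow_succ] at ih
    have hf : (0 : ℝ) < r.factorial := by positivity
    have hg : (0 : ℝ) < (r + i + 2 + i).factorial := by positivity
    push_cast at ih ⊢
    set m : ℝ := (r : ℝ) + i + 2 with hm
    have hm0 : 0 < m := by positivity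
    have hr0 : (0 : ℝ) < r + 1 := by positivity
    set A := m ^ r
    set B := m ^ (r + i + 2 + i)
    set F := (r.factorial : ℝ)
    set G := ((r + i + 2 + i).factorial : ℝ)
    have hB : 0 < B := by positivity
    calc A / F = (A * m / ((r + 1) * F)) * ((r + 1) / m) := by field_simp
      _ ≤ (B / G) * ((r + 1) / m) := by gcongr
      _ ≤ (B / G) * (m / (m + i + 1)) := by
        gcongr (B / G) * ?_
        -- As `r + 1 = m - (i + 1)`, this is `(m - (i + 1)) * (m + (i + 1)) ≤ m ^ 2`.
        rw [div_le_div_iff₀ hm0 (by positivity)]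
        rw [hm]
        nlinarith [sq_nonneg ((i : ℝ) + 1)]
      _ = _ := by field_simp

/-- The median of the Poisson distribution with positive integral mean `m` is at least `m`. -/
lemma poissonSum_self_le_half (m : ℕ) : poissonSum m m ≤ 1 / 2 := by
  have hsum : HasSum (fun j : ℕ => Real.exp (-(m : ℝ)) * (m : ℝ) ^ j / j.factorial) 1 := by
    simpa using ProbabilityTheory.hasSum_one_poissonMeasure (m : NNReal)
  have h2 : ∑ j ∈ Finset.range (m + m), Real.exp (-(m : ℝ)) * (m : ℝ) ^ j / j.factorial ≤ 1 :=
    sum_le_hasSum _ (fun j _ => by positivity) hsum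
  rw [Finset.sum_range_add] at h2
  have h3 : poissonSum m m ≤ ∑ i ∈ Finset.range m,
      Real.exp (-(m : ℝ)) * (m : ℝ) ^ (m + i) / (m + i).factorial := by
    -- Pair the weight at `m - 1 - i` with the one at `m + i`: the lower half of the first `2 * m`
    -- weights is at most the upper half, and both together are at most `1`.
    rw [poissonSum, ← Finset.sum_range_reflect]
    refine Finset.sum_le_sum fun i hi => ?_
    rw [mul_div_assoc, mul_div_assoc]
    exact mul_le_mul_of_nonneg_left (pow_div_factorial_le m i (Finset.mem_range.1 hi))
      (Real.exp_pos _).le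
  rw [poissonSum] at h3 ⊢
  linarith

/-- The Poisson distribution function at `k`, at a fixed multiple `t ≤ 1` of `k + 1`, increases
with `k`. -/
lemma poissonSum_mul_le (k : ℕ) (t : ℝ) (ht : 0 ≤ t) (ht1 : t ≤ 1) :
    poissonSum (k + 1) ((k + 1) * t) ≤ poissonSum (k + 2) ((k + 2) * t) := by
  rcases ht.eq_or_lt with rfl | ht
  · simp [poissonSum_succ_zero]
  -- Passing from `k + 1` to `k + 2` terms gains the weight at `k + 1`; moving the mean by `t` loses
  -- `t` times that weight at an intermediate mean `c`. The claim `key` is that the loss does not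
  -- exceed the gain.
  obtain ⟨c, hc, hc'⟩ := exists_hasDerivAt_eq_slope (poissonSum (k + 2))
    (fun x => -(Real.exp (-x) * x ^ (k + 1) / (k + 1).factorial))
    (show ((k : ℝ) + 1) * t < (k + 2) * t by nlinarith)
    (continuous_poissonSum_succ (k + 1)).continuousOn
    fun x _ => hasDerivAt_poissonSum_succ (k + 1) x
  have e : ((k : ℝ) + 2) * t - (k + 1) * t = t := by ring
  rw [e, eq_div_iff ht.ne'] at hc'
  have hs : poissonSum (k + 2) ((k + 1) * t) = poissonSum (k + 1) ((k + 1) * t) +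
      Real.exp (-((k + 1) * t)) * ((k + 1) * t) ^ (k + 1) / (k + 1).factorial := by
    rw [poissonSum, Finset.sum_range_succ, poissonSum]
  have key : Real.exp (-c) * c ^ (k + 1) * t ≤
      Real.exp (-((k + 1) * t)) * ((k + 1) * t) ^ (k + 1) := by
    set v : ℝ := c / t - (k + 1) with hv
    have hcv : c = t * (k + 1 + v) := by rw [hv]; field_simp; ring
    have hv0 : 0 < v := by
      rw [hv, sub_pos, lt_div_iff₀ ht]; exact hc.1
    have hv1 : v < 1 := by
      rw [hv, sub_lt_iff_lt_add, div_lt_iff₀ ht]; linarith [hc.2]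
    have h1 : (k + 1 + v) ^ (k + 1) ≤ ((k : ℝ) + 1) ^ (k + 1) * Real.exp v := by
      have : (k + 1 + v : ℝ) ≤ (k + 1) * Real.exp (v / (k + 1)) := by
        have h := Real.add_one_le_exp (v / (k + 1))
        calc (k + 1 + v : ℝ) = (k + 1) * (v / (k + 1) + 1) := by field_simp; ring
          _ ≤ _ := by gcongr
      calc (k + 1 + v) ^ (k + 1) ≤ ((k + 1) * Real.exp (v / (k + 1))) ^ (k + 1) := by gcongr
        _ = _ := by
          rw [mul_pow, ← Real.exp_nat_mul]
          congr 2
          push_cast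
          field_simp
    -- Here `t ≤ 1` enters: `1 - (1 - t) * v - t = (1 - t) * (1 - v) ≥ 0`.
    have h2 : t ≤ Real.exp (-((1 - t) * v)) := by
      have := Real.add_one_le_exp (-((1 - t) * v))
      nlinarith
    have h3 : t * Real.exp ((1 - t) * v) ≤ 1 := by
      calc t * Real.exp ((1 - t) * v) ≤ Real.exp (-((1 - t) * v)) * Real.exp ((1 - t) * v) := by
            gcongr
        _ = 1 := by rw [← Real.exp_add]; simp
    calc Real.exp (-c) * c ^ (k + 1) * t
        = Real.exp (-c) * t ^ (k + 1) * (k + 1 + v) ^ (k + 1) * t := by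
          rw [hcv, mul_pow]; ring
      _ ≤ Real.exp (-c) * t ^ (k + 1) * (((k : ℝ) + 1) ^ (k + 1) * Real.exp v) * t := by gcongr
      _ = Real.exp (-((k + 1) * t)) * ((k + 1) * t) ^ (k + 1) * (t * Real.exp ((1 - t) * v)) := by
          have : Real.exp (-c) * Real.exp v =
              Real.exp (-((k + 1) * t)) * Real.exp ((1 - t) * v) := by
            rw [← Real.exp_add, ← Real.exp_add, hcv]; congr 1; ring
          rw [mul_pow]
          linear_combination t ^ (k + 1) * ((k : ℝ) + 1) ^ (k + 1) * t * this
      _ ≤ _ := mul_le_of_le_one_right (by positivity) h3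
  have key2 : Real.exp (-c) * c ^ (k + 1) / (k + 1).factorial * t ≤
      Real.exp (-((k + 1) * t)) * ((k + 1) * t) ^ (k + 1) / (k + 1).factorial := by
    rw [div_mul_eq_mul_div]; gcongr
  linarith

/-- Intermediate values on `[0, k + 1]`: the sum is `1` at `0`, and at most `1 / 2` at `k + 1` by
the median bound. Existence alone makes `Function.invFun` a right inverse at `γ`. -/
lemma exists_poissonSum_succ_eq (k : ℕ) {γ : ℝ} (h : 1 / 2 ≤ γ) (h1 : γ ≤ 1) :
    ∃ x : NNReal, poissonQ (k + 1) x = γ := by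
  obtain ⟨x, hx, rfl⟩ := intermediate_value_Icc' (show (0 : ℝ) ≤ ((k + 1 : ℕ) : ℝ) by positivity)
    (continuous_poissonSum_succ k).continuousOn
    ⟨(poissonSum_self_le_half (k + 1)).trans h, h1.trans (poissonSum_succ_zero k).ge⟩
  exact ⟨⟨x, hx.1⟩, poissonQ_eq_poissonSum _ _⟩

lemma poissonQInv_nonneg (k : ℕ) (γ : ℝ) : 0 ≤ poissonQInv k γ := NNReal.coe_nonneg _

lemma poissonSum_poissonQInv (k : ℕ) {γ : ℝ} (h : 1 / 2 ≤ γ) (h1 : γ ≤ 1) :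
    poissonSum (k + 1) (poissonQInv (k + 1) γ) = γ := by
  rw [poissonQInv, ← poissonQ_eq_poissonSum]
  exact Function.invFun_eq (exists_poissonSum_succ_eq k h h1)

lemma poissonQInv_pos (k : ℕ) {γ : ℝ} (h : 1 / 2 ≤ γ) (h1 : γ < 1) :
    0 < poissonQInv (k + 1) γ := by
  refine (poissonQInv_nonneg _ _).lt_of_ne fun h0 => ?_
  have := poissonSum_poissonQInv k h h1.le
  rw [← h0, poissonSum_succ_zero] at this
  exact h1.ne' this

/-- For `γ ≥ 1 / 2`, the quotient `Q⁻¹(k, γ) / k` is nondecreasing in `k`. -/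
lemma monotone_poissonQInv_div {γ : ℝ} (h : 1 / 2 ≤ γ) (h1 : γ ≤ 1) :
    Monotone fun k : ℕ => poissonQInv (k + 1) γ / ((k : ℝ) + 1) := by
  refine monotone_nat_of_le_succ fun k => ?_
  set t : ℝ := poissonQInv (k + 1) γ / ((k : ℝ) + 1) with ht
  have hk : (0 : ℝ) < k + 1 := by positivity
  have hl : poissonQInv (k + 1) γ = (k + 1) * t := by rw [ht]; field_simp
  have ht0 : 0 ≤ t := div_nonneg (poissonQInv_nonneg _ _) hk.le
  have hq := poissonSum_poissonQInv k h h1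
  -- Otherwise the inverse exceeds `k + 1`, where the sum is already at most `1 / 2 ≤ γ`,
  -- contradicting strict decrease.
  have ht1 : t ≤ 1 := by
    rw [ht, div_le_one hk]
    by_contra! hlt
    have h2 := strictAntiOn_poissonSum_succ k (Set.mem_Ici.2 hk.le)
      (Set.mem_Ici.2 (poissonQInv_nonneg _ _)) hlt
    have h3 := poissonSum_self_le_half (k + 1)
    push_cast at h3
    linarith
  have h4 := poissonSum_mul_le k t ht0 ht1
  rw [← hl, hq, ← poissonSum_poissonQInv (k + 1) h h1] at h4
  have h5 := (strictAntiOn_poissonSum_succ (k + 1)).le_iff_ge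
    (Set.mem_Ici.2 (poissonQInv_nonneg (k + 1 + 1) γ))
    (Set.mem_Ici.2 (show 0 ≤ ((k : ℝ) + 2) * t by positivity))
  have h6 := h5.1 h4
  rw [le_div_iff₀ (by positivity)]
  push_cast
  linarith


/-! ### Any-Fit packings -/

section AnyFit

variable {ι : Type*} {w : ι → ℝ} {i : ι} {bins bins' : List (List ι)}

/-- Any two bins of an Any-Fit packing have a total content of more than `1`. -/
lemma PackAnyFit.pairwise (h : PackAnyFit w i bins bins') (hw : 0 ≤ w i)
    (hb : bins.Pairwise fun b b' => 1 < (b.map w).sum + (b'.map w).sum) :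
    bins'.Pairwise fun b b' => 1 < (b.map w).sum + (b'.map w).sum := by
  cases h with
  | intoOpen pre b post h =>
    rw [List.pairwise_append, List.pairwise_cons] at hb ⊢
    obtain ⟨h1, ⟨h2, h3⟩, h4⟩ := hb
    refine ⟨h1, ⟨fun b' hb' => ?_, h3⟩, fun a ha b' hb' => ?_⟩
    · have := h2 b' hb'
      simp only [List.map_cons, List.sum_cons]
      linarith
    · rcases List.mem_cons.1 hb' with rfl | hb'
      · have := h4 a ha b List.mem_cons_self
        simp only [List.map_cons, List.sum_cons]
        linarith
      · exact h4 a ha b' (List.mem_cons_of_mem _ hb')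
  | newBin _ h =>
    rw [List.pairwise_append]
    refine ⟨hb, List.pairwise_singleton _ _, fun a ha b' hb' => ?_⟩
    rw [List.mem_singleton.1 hb']
    simpa [Fits] using h a ha

lemma PackAnyFit.forall_mem (h : PackAnyFit w i bins bins') {Q : ι → Prop} (hi : Q i)
    (hb : ∀ b ∈ bins, ∀ j ∈ b, Q j) : ∀ b ∈ bins', ∀ j ∈ b, Q j := by
  cases h with
  | intoOpen pre b post h =>
    intro b' hb' j hj
    simp only [List.mem_append, List.mem_cons] at hb' hb
    rcases hb' with hb' | rfl | hb'
    · exact hb b' (Or.inl hb') j hj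
    · rcases List.mem_cons.1 hj with rfl | hj
      · exact hi
      · exact hb b (Or.inr (Or.inl rfl)) j hj
    · exact hb b' (Or.inr (Or.inr hb')) j hj
  | newBin _ h =>
    intro b' hb' j hj
    rcases List.mem_append.1 hb' with hb' | hb'
    · exact hb b' hb' j hj
    · rw [List.mem_singleton.1 hb', List.mem_singleton] at hj
      exact hj ▸ hi

lemma PackAnyFit.sum_sum (h : PackAnyFit w i bins bins') (v : ι → ℝ) :
    (bins'.map fun b => (b.map v).sum).sum = (bins.map fun b => (b.map v).sum).sum + v i := by
  cases h with
  | intoOpen pre b post h => simp; ring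
  | newBin _ h => simp

end AnyFit

/-- If any two entries of a list of at least two reals have a sum above `1`, the average is at
least `1 / 2`. -/
lemma length_le_two_mul_sum {l : List ℝ} (h : l.Pairwise fun a b => 1 < a + b)
    (hl : 2 ≤ l.length) : (l.length : ℝ) ≤ 2 * l.sum := by
  -- This sums the hypothesis over all pairs, each entry lying in `length - 1` of them. Keeping that
  -- factor lets the induction start from the empty list; it is cancelled at the end using `2 ≤
  -- length`.
  have key : ∀ l : List ℝ, (l.Pairwise fun a b => 1 < a + b) →
      (l.length : ℝ) * ((l.length : ℝ) - 1) ≤ 2 * (((l.length : ℝ) - 1) * l.sum) := by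
    intro l
    induction l with
    | nil => simp
    | cons x xs ih =>
      intro h
      rw [List.pairwise_cons] at h
      have h1 : (xs.length : ℝ) ≤ xs.length * x + xs.sum := by
        have : ∀ ys : List ℝ, (∀ y ∈ ys, 1 < x + y) → (ys.length : ℝ) ≤ ys.length * x + ys.sum := by
          intro ys
          induction ys with
          | nil => simp
          | cons y ys ih =>
            intro hy
            have h2 := ih fun z hz => hy z (List.mem_cons_of_mem _ hz)
            have h3 := hy y List.mem_cons_self
            simp only [List.length_cons, List.sum_cons]
            push_cast
            linarith
        exact this xs h.1
      have h2 := ih h.2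
      simp only [List.length_cons, List.sum_cons]
      push_cast
      linarith
  have h1 := key l h
  have h2 : (2 : ℝ) ≤ l.length := by exact_mod_cast hl
  nlinarith

/-! ### Runs of RPAP -/

section Run

variable {ι : Type*} {α smin pmax : ℝ} {p s : ι → ℝ} {l : List ι} {st : Group → List (List ι)}

lemma RPAPRun.groupOf_eq (h : RPAPRun α smin pmax p s l st) (g : Group) :
    ∀ b ∈ st g, ∀ i ∈ b, groupOf smin pmax (p i) (s i) = g := by
  induction h with
  | start => simp
  | step l st i g' bins hrun hg hpack ih =>
    by_cases hgg : g = g'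
    · subst hgg
      rw [Function.update_self]
      exact hpack.forall_mem hg.symm ih
    · rw [Function.update_of_ne hgg]
      exact ih

lemma RPAPRun.pairwise (h : RPAPRun α smin pmax p s l st)
    (hw : ∀ i g, 0 ≤ packSize α smin (p i) (s i) g) (g : Group) :
    (st g).Pairwise fun b b' =>
      1 < (b.map fun i => packSize α smin (p i) (s i) g).sum +
        (b'.map fun i => packSize α smin (p i) (s i) g).sum := by
  induction h with
  | start => simp
  | step l st i g' bins hrun hg hpack ih =>
    by_cases hgg : g = g'
    · subst hgg
      rw [Function.update_self]
      exact hpack.pairwise (hw i g) ih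
    · rw [Function.update_of_ne hgg]
      exact ih

lemma RPAPRun.sum_le (h : RPAPRun α smin pmax p s l st) {v : ι → ℝ} (hv : ∀ i, 0 ≤ v i)
    (G : Finset Group) :
    ∑ g ∈ G, ((st g).map fun b => (b.map v).sum).sum ≤ (l.map v).sum := by
  induction h with
  | start => simp
  | step l st i g' bins hrun hg hpack ih =>
    have h1 : ∀ g, ((Function.update st g' bins g).map fun b => (b.map v).sum).sum =
        ((st g).map fun b => (b.map v).sum).sum + if g = g' then v i else 0 := by
      intro g
      by_cases hgg : g = g'
      · subst hgg
        rw [Function.update_self, hpack.sum_sum v, if_pos rfl]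
      · rw [Function.update_of_ne hgg, if_neg hgg, add_zero]
    simp_rw [h1]
    rw [Finset.sum_add_distrib, Finset.sum_ite_eq', List.map_append, List.sum_append]
    have h2 : (if g' ∈ G then v i else 0) ≤ v i := by
      split_ifs
      exacts [le_rfl, hv i]
    simpa using add_le_add ih h2

/-- If the load of each item is at least `2 * c` times its packing size, a group with at least
two bins has an average load of at least `c` per bin. -/
lemma RPAPRun.mul_length_le (h : RPAPRun α smin pmax p s l st)
    (hw : ∀ i g, 0 ≤ packSize α smin (p i) (s i) g) {c : ℝ} (hc : 0 ≤ c) {v : ι → ℝ}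
    (hv : ∀ i g, groupOf smin pmax (p i) (s i) = g →
      2 * c * packSize α smin (p i) (s i) g ≤ v i)
    {g : Group} (hg : 2 ≤ (st g).length) :
    c * (st g).length ≤ ((st g).map fun b => (b.map v).sum).sum := by
  have h1 := length_le_two_mul_sum
    (l := (st g).map fun b => (b.map fun i => packSize α smin (p i) (s i) g).sum)
    (List.pairwise_map.2 (h.pairwise hw g)) (by simpa using hg)
  rw [List.length_map] at h1
  calc c * (st g).length
      ≤ c * (2 * ((st g).map fun b => (b.map fun i => packSize α smin (p i) (s i) g).sum).sum) := by
        gcongr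
    _ = ((st g).map fun b => (b.map fun i => 2 * c * packSize α smin (p i) (s i) g).sum).sum := by
        simp_rw [List.sum_map_mul_left]
        ring
    _ ≤ _ := List.sum_le_sum fun b hb => List.sum_le_sum fun i hi =>
        hv i g (h.groupOf_eq g b hb i hi)

end Run

/-! ### The constants -/

section Constants

variable {α smax smin pmax p s : ℝ}

lemma muZero_pos (hα : 0 < α) (hsmin : 0 < smin) : 0 < muZero α smin := by
  refine div_pos ?_ (by positivity)
  rw [sub_pos, Real.sqrt_lt' (by positivity)]
  nlinarith [mul_pos hα hα]

/-- Isolating the square root and squaring turns the claim into `smin * pmax ≤ α * (1 - pmax) ^ 2`,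
which is the hypothesis `h`. -/
lemma le_muZero (hα : 0 < α) (hsmin : 0 < smin) (hpmax : 0 < pmax) (hpmax' : pmax < 1)
    (h : smin ≤ α * (1 - pmax) ^ 2 / pmax) : pmax ≤ muZero α smin := by
  rw [le_div_iff₀ hpmax] at h
  have h1 : √(smin ^ 2 + 4 * α * smin) ≤ 2 * α * (1 - pmax) + smin := by
    rw [Real.sqrt_le_left (by nlinarith)]
    nlinarith [mul_le_mul_of_nonneg_left h hα.le]
  rw [muZero, le_div_iff₀ (by positivity)]
  linarith

lemma lamMin_pos (hα : 0 < α) (hα' : α ≤ 1 / 2) : 0 < lamMin α smax :=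
  div_pos (poissonQInv_pos _ (by linarith) (by linarith)) (by positivity)

lemma muMin_pos (hα : 0 < α) (hα' : α ≤ 1 / 2) (hsmin : 0 < smin) (hpmax : 0 < pmax)
    (hpmax' : pmax < 1) : 0 < muMin α smax smin pmax :=
  mul_pos (by norm_num) (lt_min hpmax (lt_min (muZero_pos hα hsmin)
    (mul_pos (by linarith) (lamMin_pos hα hα'))))

lemma packSize_nonneg (hα : 0 < α) (hsmin : 0 < smin) (hp : 0 ≤ p) (hp' : p ≤ 1) (hs : 0 ≤ s)
    (g : Group) : 0 ≤ packSize α smin p s g := by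
  cases g with
  | confident => exact hs
  | minor => exact div_nonneg (mul_nonneg hp hs) (muZero_pos hα hsmin).le
  | standard k =>
    refine div_nonneg ?_ (poissonQInv_nonneg _ _)
    rw [one_div, Real.log_inv, neg_nonneg]
    exact Real.log_nonpos (by linarith) (by linarith)

/-- Each term of the minimum in `muMin` serves one kind of group: `pmax` confident items, `muZero`
minor ones (with equality), and `(1 - pmax) * lamMin` standard ones, through `λ_k / (k + 1) ≥
lamMin` and `(k + 1) * s ≥ 1`. -/
lemma two_mul_muMin_mul_packSize_le (hα : 0 < α) (hα' : α ≤ 1 / 2) (hsmin : 0 < smin)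
    (hpmax' : pmax < 1) (hp : 0 ≤ p) (hp' : p ≤ 1) (hs : 0 < s)
    (hs' : s ≤ smax) {g : Group} (hg : groupOf smin pmax p s = g) :
    2 * muMin α smax smin pmax * packSize α smin p s g ≤ p * s := by
  have hw := packSize_nonneg hα hsmin hp hp' hs.le g
  have e : 2 * muMin α smax smin pmax =
      min pmax (min (muZero α smin) ((1 - pmax) * lamMin α smax)) := by rw [muMin]; ring
  rw [e]
  subst hg
  unfold groupOf at hw ⊢
  split_ifs at hw ⊢ with h1 h2
  · refine (mul_le_mul_of_nonneg_right (min_le_left _ _) hw).trans ?_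
    exact mul_le_mul_of_nonneg_right h1.le hs.le
  · refine (mul_le_mul_of_nonneg_right ((min_le_right _ _).trans (min_le_left _ _)) hw).trans ?_
    exact (mul_div_cancel₀ _ (muZero_pos hα hsmin).ne').le
  · refine (mul_le_mul_of_nonneg_right ((min_le_right _ _).trans (min_le_right _ _)) hw).trans ?_
    set k := ⌊1 / s⌋₊
    have hk : ⌊1 / smax⌋₊ ≤ k := Nat.floor_le_floor (one_div_le_one_div_of_le hs hs')
    have hmono : lamMin α smax ≤ lam α k / ((k : ℝ) + 1) :=
      monotone_poissonQInv_div (show 1 / 2 ≤ 1 - α by linarith) (by linarith) hk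
    have hk1 : 1 ≤ ((k : ℝ) + 1) * s := by
      have := Nat.lt_floor_add_one (1 / s)
      rw [div_lt_iff₀ hs] at this
      exact this.le
    have hlam : 0 < lam α k := poissonQInv_pos k (by linarith) (by linarith)
    -- From `log y ≤ y - 1` at `y = 1 / (1 - p)`, together with `1 - pmax ≤ 1 - p`.
    have hlog : (1 - pmax) * Real.log (1 / (1 - p)) ≤ p := by
      have hp1 : 0 < 1 - p := by linarith
      have h3 := Real.log_le_sub_one_of_pos (show 0 < 1 / (1 - p) by positivity)
      have h4 : (1 - p) * (1 / (1 - p) - 1) = p := by field_simp; ring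
      have h5 : 0 ≤ Real.log (1 / (1 - p)) := by
        rw [one_div, Real.log_inv, neg_nonneg]
        exact Real.log_nonpos hp1.le (by linarith)
      nlinarith
    calc (1 - pmax) * lamMin α smax * packSize α smin p s (Group.standard k)
        ≤ (1 - pmax) * (lam α k / ((k : ℝ) + 1)) * packSize α smin p s (Group.standard k) := by
          have : 0 ≤ 1 - pmax := by linarith
          gcongr
      _ = (1 - pmax) * Real.log (1 / (1 - p)) / ((k : ℝ) + 1) := by
          rw [packSize]; field_simp
      _ ≤ p / ((k : ℝ) + 1) := by gcongr
      _ ≤ p * s := by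
          rw [div_le_iff₀ (by positivity)]
          nlinarith

/-- The terms of `muMin` that increase and decrease with `pmax` balance at
`lamMin / (1 + lamMin)`. -/
lemma two_mul_muMin_le (hα : 0 < α) (hα' : α ≤ 1 / 2) :
    2 * muMin α smax smin pmax ≤ lamMin α smax / (1 + lamMin α smax) := by
  have hl := lamMin_pos (smax := smax) hα hα'
  have e : 2 * muMin α smax smin pmax =
      min pmax (min (muZero α smin) ((1 - pmax) * lamMin α smax)) := by rw [muMin]; ring
  rw [e]
  rcases le_total pmax (lamMin α smax / (1 + lamMin α smax)) with h | h
  · exact (min_le_left _ _).trans h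
  · refine ((min_le_right _ _).trans (min_le_right _ _)).trans ?_
    rw [div_le_iff₀ (by positivity)] at h
    rw [le_div_iff₀ (by positivity)]
    nlinarith

lemma two_mul_muMin_eq (hα : 0 < α) (hα' : α ≤ 1 / 2) (hsmin : 0 < smin) (hpmax : 0 < pmax)
    (hpmax' : pmax < 1) (h : pmax = lamMin α smax / (1 + lamMin α smax))
    (h' : smin ≤ α * (1 - pmax) ^ 2 / pmax) :
    2 * muMin α smax smin pmax = lamMin α smax / (1 + lamMin α smax) := by
  have hl := lamMin_pos (smax := smax) hα hα'
  have e : (1 - pmax) * lamMin α smax = pmax := by rw [h]; field_simp; ring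
  rw [muMin, e, min_eq_right (le_muZero hα hsmin hpmax hpmax' h'), min_self, ← h]
  ring

lemma approxConst_eq : approxConst α smax smin pmax =
    2 * ((1 + α) / (1 - α)) * (1 / (2 * muMin α smax smin pmax)) := by
  rw [approxConst, ← div_div, ← one_div_mul_one_div]
  ring

end Constants


/-! ### The expected load of a viable bin -/

section Load

open MeasureTheory ProbabilityTheory

variable {Ω ι : Type*} [MeasurableSpace Ω] {P : Measure Ω} [IsProbabilityMeasure P]
  {X : ι → Ω → ℝ}

/-- Add the items one at a time. While the partial sum is at most `1`, a new item keeps it at most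
`2`, so the truncated sum gains all of `X a`; otherwise it does not decrease. By independence the
expected gain is at least `P(partial sum ≤ 1) * E (X a)`, and this probability can only fall as
items are added. -/
lemma measureReal_sum_le_one_mul_integral_le (hm : ∀ i, AEMeasurable (X i) P)
    (hX : ∀ i, ∀ᵐ ω ∂P, X i ω ∈ Set.Icc (0 : ℝ) 1) (hindep : iIndepFun X P) (T : Finset ι) :
    P.real {ω | ∑ i ∈ T, X i ω ≤ 1} * ∑ i ∈ T, ∫ ω, X i ω ∂P ≤
      ∫ ω, min (∑ i ∈ T, X i ω) 2 ∂P := by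
  classical
  have hnn : ∀ T : Finset ι, ∀ᵐ ω ∂P, 0 ≤ ∑ i ∈ T, X i ω := fun T => by
    filter_upwards [(Finset.eventually_all T).2 fun i _ => hX i] with ω h
    exact Finset.sum_nonneg fun i hi => (h i hi).1
  have hSm : ∀ T : Finset ι, AEMeasurable (fun ω => ∑ i ∈ T, X i ω) P := fun T =>
    Finset.aemeasurable_fun_sum T fun i _ => hm i
  have hint : ∀ T : Finset ι, Integrable (fun ω => min (∑ i ∈ T, X i ω) 2) P := fun T => by
    refine Integrable.of_bound ((hSm T).min aemeasurable_const).aestronglyMeasurable 2 ?_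
    filter_upwards [hnn T] with ω h
    rw [Real.norm_of_nonneg (le_min h zero_le_two)]
    exact min_le_right _ _
  induction T using Finset.induction_on with
  | empty => simp
  | insert a T ha ih =>
    set f : ℝ → ℝ := Set.indicator (Set.Iic 1) 1 with hf
    have hfm : Measurable f := measurable_one.indicator measurableSet_Iic
    have hfS : AEMeasurable (fun ω => f (∑ i ∈ T, X i ω)) P := hfm.comp_aemeasurable (hSm T)
    have hE : ∀ i, 0 ≤ ∫ ω, X i ω ∂P := fun i => integral_nonneg_of_ae <| by
      filter_upwards [hX i] with ω h using h.1
    have hprob : P.real {ω | ∑ i ∈ T, X i ω ≤ 1} = ∫ ω, f (∑ i ∈ T, X i ω) ∂P := by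
      have h1 := integral_map (hSm T) (f := f) hfm.aestronglyMeasurable
      rw [← h1, hf, integral_indicator_one measurableSet_Iic,
        map_measureReal_apply_of_aemeasurable (hSm T) measurableSet_Iic]
      rfl
    have hprod : (∫ ω, f (∑ i ∈ T, X i ω) ∂P) * ∫ ω, X a ω ∂P =
        ∫ ω, f (∑ i ∈ T, X i ω) * X a ω ∂P := by
      have h1 : IndepFun (fun ω => ∑ i ∈ T, X i ω) (X a) P := by
        have := hindep.indepFun_finsetSum_of_notMem₀ hm ha
        convert this using 1
        ext ω; simp
      exact (h1.integral_fun_comp_mul_comp (g := id) (hSm T) (hm a) hfm.aestronglyMeasurable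
        aestronglyMeasurable_id).symm
    have hintf : Integrable (fun ω => f (∑ i ∈ T, X i ω) * X a ω) P := by
      refine Integrable.of_bound (hfS.mul (hm a)).aestronglyMeasurable 1 ?_
      filter_upwards [hX a] with ω h
      rw [hf, Set.indicator_apply]
      split_ifs
      · simpa [abs_of_nonneg h.1] using h.2
      · simp
    have hle : P.real {ω | ∑ i ∈ insert a T, X i ω ≤ 1} ≤ P.real {ω | ∑ i ∈ T, X i ω ≤ 1} := by
      refine ENNReal.toReal_mono (measure_ne_top _ _) (measure_mono_ae ?_)
      filter_upwards [hX a] with ω h h1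
      have h1 : ∑ i ∈ insert a T, X i ω ≤ 1 := h1
      rw [Finset.sum_insert ha] at h1
      show ∑ i ∈ T, X i ω ≤ 1
      linarith [h.1]
    calc P.real {ω | ∑ i ∈ insert a T, X i ω ≤ 1} * ∑ i ∈ insert a T, ∫ ω, X i ω ∂P
        ≤ P.real {ω | ∑ i ∈ T, X i ω ≤ 1} * ∑ i ∈ insert a T, ∫ ω, X i ω ∂P :=
          mul_le_mul_of_nonneg_right hle (Finset.sum_nonneg fun i _ => hE i)
      _ = P.real {ω | ∑ i ∈ T, X i ω ≤ 1} * ∑ i ∈ T, ∫ ω, X i ω ∂P +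
          ∫ ω, f (∑ i ∈ T, X i ω) * X a ω ∂P := by
          rw [Finset.sum_insert ha, ← hprod, hprob]; ring
      _ ≤ ∫ ω, min (∑ i ∈ T, X i ω) 2 ∂P + ∫ ω, f (∑ i ∈ T, X i ω) * X a ω ∂P := by gcongr
      _ = ∫ ω, (min (∑ i ∈ T, X i ω) 2 + f (∑ i ∈ T, X i ω) * X a ω) ∂P :=
          (integral_add (hint T) hintf).symm
      _ ≤ _ := by
          refine integral_mono_ae ((hint T).add hintf) (hint _) ?_
          filter_upwards [hX a] with ω h
          have h0 := h.1
          have h1 := h.2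
          simp only [Finset.sum_insert ha]
          by_cases hS : ∑ i ∈ T, X i ω ≤ 1
          · rw [hf, Set.indicator_of_mem (Set.mem_Iic.2 hS), Pi.one_apply, one_mul,
              min_eq_left (by linarith), min_eq_left (by linarith)]
            linarith
          · rw [hf, Set.indicator_of_notMem (by simpa using hS), zero_mul, add_zero]
            exact min_le_min_right _ (by linarith)

/-- A sum of independent variables in `[0, 1]` which exceeds `1` with probability at most `α` has
expected value at most `(1 + α) / (1 - α)`. -/
lemma sum_integral_le (hm : ∀ i, AEMeasurable (X i) P)
    (hX : ∀ i, ∀ᵐ ω ∂P, X i ω ∈ Set.Icc (0 : ℝ) 1) (hindep : iIndepFun X P) (T : Finset ι)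
    {α : ℝ} (hα : α < 1) (hT : P.real {ω | 1 < ∑ i ∈ T, X i ω} ≤ α) :
    ∑ i ∈ T, ∫ ω, X i ω ∂P ≤ (1 + α) / (1 - α) := by
  have hSm : AEMeasurable (fun ω => ∑ i ∈ T, X i ω) P :=
    Finset.aemeasurable_fun_sum T fun i _ => hm i
  have hnull : NullMeasurableSet {ω | 1 < ∑ i ∈ T, X i ω} P :=
    hSm.nullMeasurableSet_preimage measurableSet_Ioi
  have h1 : P.real {ω | ∑ i ∈ T, X i ω ≤ 1} = 1 - P.real {ω | 1 < ∑ i ∈ T, X i ω} := by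
    rw [← probReal_compl_eq_one_sub₀ hnull]
    congr 1; ext ω; simp
  -- Pointwise, the truncated sum is at most `1`, plus `1` more on overflow.
  have h2 : ∫ ω, min (∑ i ∈ T, X i ω) 2 ∂P ≤ 1 + P.real {ω | 1 < ∑ i ∈ T, X i ω} := by
    have hi : Integrable (fun ω => Set.indicator {ω | 1 < ∑ i ∈ T, X i ω} (1 : Ω → ℝ) ω) P :=
      (integrable_const (1 : ℝ)).indicator₀ hnull
    calc ∫ ω, min (∑ i ∈ T, X i ω) 2 ∂P
        ≤ ∫ ω, (1 + Set.indicator {ω | 1 < ∑ i ∈ T, X i ω} (1 : Ω → ℝ) ω) ∂P := by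
          refine integral_mono_of_nonneg ?_ ((integrable_const _).add hi) ?_
          · filter_upwards [(Finset.eventually_all T).2 fun i _ => hX i] with ω h
            exact le_min (Finset.sum_nonneg fun i hi => (h i hi).1) zero_le_two
          · refine Filter.Eventually.of_forall fun ω => ?_
            by_cases h : 1 < ∑ i ∈ T, X i ω
            · simp only [Set.indicator_of_mem (show ω ∈ {ω | 1 < ∑ i ∈ T, X i ω} from h),
                Pi.one_apply]
              exact (min_le_right _ _).trans (by norm_num)
            · simp only [Set.indicator_of_notMem (show ω ∉ {ω | 1 < ∑ i ∈ T, X i ω} from h),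
                add_zero]
              exact (min_le_left _ _).trans (not_lt.1 h)
      _ = _ := by
          rw [integral_add (integrable_const _) hi, integral_indicator₀ hnull]
          simp
  have h3 := measureReal_sum_le_one_mul_integral_le hm hX hindep T
  have h4 : 0 ≤ ∑ i ∈ T, ∫ ω, X i ω ∂P := Finset.sum_nonneg fun i _ =>
    integral_nonneg_of_ae <| by filter_upwards [hX i] with ω h using h.1
  rw [le_div_iff₀ (by linarith)]
  -- With overflow probability `q ≤ α` and expected load `E ≥ 0`: `(1 - α) * E ≤ (1 - q) * E ≤ 1 + q
  -- ≤ 1 + α`.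
  nlinarith

omit [IsProbabilityMeasure P] in
lemma hasLaw_bernoulli_mem_Icc {Y : Ω → ℝ} {p : unitInterval} {s : ℝ} (hs : 0 ≤ s) (hs' : s ≤ 1)
    (h : HasLaw Y (bernoulliMeasure s 0 p) P) : ∀ᵐ ω ∂P, Y ω ∈ Set.Icc (0 : ℝ) 1 := by
  have h1 : P {ω | Y ω ∉ Set.Icc (0 : ℝ) 1} = 0 := by
    rw [h.measure_eq (p := fun y => y ∉ Set.Icc (0 : ℝ) 1) measurableSet_Icc.compl]
    exact bernoulliMeasure_apply_of_notMem_of_notMem p measurableSet_Icc.compl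
      (by simp [hs, hs']) (by simp)
  exact h1

omit [IsProbabilityMeasure P] in
lemma hasLaw_bernoulli_integral {Y : Ω → ℝ} {p : unitInterval} {s : ℝ}
    (h : HasLaw Y (bernoulliMeasure s 0 p) P) : ∫ ω, Y ω ∂P = p * s := by
  rw [h.integral_eq, integral_bernoulliMeasure]
  simp

end Load


/-! ### The number of bins -/

/-- The groups whose bins RPAP returns. -/
noncomputable def groups (smax smin : ℝ) : Finset Group :=
  insert Group.confident (insert Group.minor
    ((Finset.Icc (kMin smax) (kMax smin)).image Group.standard))

lemma sum_groups {M : Type*} [AddCommMonoid M] (smax smin : ℝ) (f : Group → M) :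
    ∑ g ∈ groups smax smin, f g = f Group.confident + (f Group.minor +
      ∑ k ∈ Finset.Icc (kMin smax) (kMax smin), f (Group.standard k)) := by
  rw [groups, Finset.sum_insert (by simp), Finset.sum_insert (by simp),
    Finset.sum_image fun _ _ _ _ h => Group.standard.inj h]

/-- The strict inequality `smin < smax` absorbs the `- 1` in `kMax`. It is used to count the groups
without truncated subtraction. -/
lemma kMin_le_kMax {smax smin : ℝ} (hsmin : 0 < smin) (hsmin' : smin < smax) :
    kMin smax ≤ kMax smin := by
  have h1 : (kMin smax : ℝ) < (⌈1 / smin⌉₊ : ℝ) :=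
    calc (kMin smax : ℝ) ≤ 1 / smax := Nat.floor_le (one_div_nonneg.2 (hsmin.trans hsmin').le)
      _ < 1 / smin := one_div_lt_one_div_of_lt hsmin hsmin'
      _ ≤ _ := Nat.le_ceil _
  exact Nat.le_sub_one_of_lt (by exact_mod_cast h1)

/-- All but one bin of each group are in groups with at least two bins. -/
lemma binCount_le {ι : Type*} {smax smin : ℝ} (hsmin : 0 < smin) (hsmin' : smin < smax)
    (st : Group → List (List ι)) :
    (binCount smax smin st : ℝ) ≤
      ∑ g ∈ groups smax smin with 2 ≤ (st g).length, ((st g).length : ℝ) +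
        (kMax smin : ℝ) - (kMin smax : ℝ) + 3 := by
  have hb : binCount smax smin st = ∑ g ∈ groups smax smin, (st g).length := by
    rw [sum_groups, binCount, add_assoc]
  have hcard : ((∑ _g ∈ groups smax smin, 1 : ℕ) : ℝ) = (kMax smin : ℝ) - kMin smax + 3 := by
    have := kMin_le_kMax hsmin hsmin'
    rw [sum_groups, Finset.sum_const, Nat.card_Icc, smul_eq_mul, mul_one]
    push_cast [Nat.cast_sub (show kMin smax ≤ kMax smin + 1 by omega)]
    ring
  have hle : (binCount smax smin st : ℝ) ≤
      ∑ g ∈ groups smax smin, ((if 2 ≤ (st g).length then ((st g).length : ℝ) else 0) + 1) := by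
    rw [hb]
    push_cast
    refine Finset.sum_le_sum fun g _ => ?_
    split_ifs with h
    · linarith
    · have : (st g).length ≤ 1 := by omega
      simpa using this
  rw [Finset.sum_add_distrib, ← Finset.sum_filter] at hle
  push_cast at hcard
  linarith

end StochPack

/-- The approximation guarantee of RPAP. The conclusion consists of: the lower bound `μ_min` on
the average expected value of the bins in any subgroups having at least two bins; the bound on the
number of bins; the fact that the value `λ_min / (1 + λ_min)` of `p_max` is admissible; the
minimal value of the approximation constant over all admissible parameters, and that it is
attained for this `p_max` and all small enough `s_min`, together with its form for `s_max = 1`. -/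
theorem mainTheorem1 {Ω : Type*} [MeasurableSpace Ω] (P : MeasureTheory.Measure Ω)
    [MeasureTheory.IsProbabilityMeasure P]
    (α smax smin pmax : ℝ)
    (hα : 0 < α) (hα' : α ≤ 1 / 2)
    (hsmax : smax ≤ 1)
    (hsmin : 0 < smin) (hsmin' : smin < smax)
    (hpmax : 0 < pmax) (hpmax' : pmax < 1)
    (n : ℕ) (p : Fin n → unitInterval) (s : Fin n → ℝ)
    (hp : ∀ i, 0 < p i) (hs : ∀ i, 0 < s i) (hs' : ∀ i, s i ≤ smax)
    (X : Fin n → Ω → ℝ)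
    (hlaw : ∀ i, ProbabilityTheory.HasLaw (X i)
      (ProbabilityTheory.bernoulliMeasure (s i) 0 (p i)) P)
    (hindep : ProbabilityTheory.iIndepFun X P)
    (st : StochPack.Group → List (List (Fin n)))
    (hrun : StochPack.RPAPRun α smin pmax (fun i => (p i : ℝ)) s (List.finRange n) st)
    (OPT : ℕ) (hOPT : StochPack.IsOptimalBinCount P X α OPT) :
    (∀ G : Finset StochPack.Group, G.Nonempty → (∀ g ∈ G, 2 ≤ (st g).length) →
      StochPack.muMin α smax smin pmax ≤
        StochPack.avgExpected (fun i => (p i : ℝ)) s st G) ∧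
    (StochPack.binCount smax smin st : ℝ) ≤
      StochPack.approxConst α smax smin pmax * OPT
        + (StochPack.kMax smin : ℝ) - (StochPack.kMin smax : ℝ) + 3 ∧
    (0 < StochPack.lamMin α smax / (1 + StochPack.lamMin α smax) ∧
      StochPack.lamMin α smax / (1 + StochPack.lamMin α smax) < 1) ∧
    2 * ((1 + α) / (1 - α)) * ((1 + StochPack.lamMin α smax) / StochPack.lamMin α smax) ≤
      StochPack.approxConst α smax smin pmax ∧
    (pmax = StochPack.lamMin α smax / (1 + StochPack.lamMin α smax) →
      smin ≤ α * (1 - pmax) ^ 2 / pmax →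
      StochPack.approxConst α smax smin pmax =
        2 * ((1 + α) / (1 - α)) *
          ((1 + StochPack.lamMin α smax) / StochPack.lamMin α smax) ∧
      (smax = 1 → StochPack.approxConst α smax smin pmax =
        2 * ((1 + α) / (1 - α)) * (1 + 2 / StochPack.poissonQInv 2 (1 - α)))) := by
  have hα1 : 0 < 1 - α := by linarith
  have hlam := StochPack.lamMin_pos (smax := smax) hα hα'
  have hmu := StochPack.muMin_pos (smax := smax) hα hα' hsmin hpmax hpmax'
  have hload : ∀ g, 2 ≤ (st g).length → StochPack.muMin α smax smin pmax * (st g).length ≤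
      ((st g).map fun b => (b.map fun i => (p i : ℝ) * s i).sum).sum := fun g hg =>
    hrun.mul_length_le
      (fun i g => StochPack.packSize_nonneg hα hsmin (p i).2.1 (p i).2.2 (hs i).le g) hmu.le
      (fun i g hg => StochPack.two_mul_muMin_mul_packSize_le hα hα' hsmin hpmax'
        (p i).2.1 (p i).2.2 (hs i) (hs' i) hg) hg
  have hloads : ∀ G : Finset StochPack.Group, (∀ g ∈ G, 2 ≤ (st g).length) →
      StochPack.muMin α smax smin pmax * ∑ g ∈ G, ((st g).length : ℝ) ≤
        ∑ g ∈ G, ((st g).map fun b => (b.map fun i => (p i : ℝ) * s i).sum).sum := by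
    intro G hG
    rw [Finset.mul_sum]
    exact Finset.sum_le_sum fun g hg => hload g (hG g hg)
  have hratio : 0 < StochPack.lamMin α smax / (1 + StochPack.lamMin α smax) := by positivity
  refine ⟨fun G hne hG => ?_, ?_, ⟨hratio, ?_⟩, ?_, fun h h' => ?_⟩
  · rw [StochPack.avgExpected, Nat.cast_sum, le_div_iff₀]
    · exact hloads G hG
    · refine Finset.sum_pos (fun g hg => ?_) hne
      have := hG g hg
      exact_mod_cast (by omega : 0 < (st g).length)
  · obtain ⟨f, hf⟩ := hOPT.1
    -- Split the total load over the bins of an optimal viable assignment.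
    have htotal : ∑ i, (p i : ℝ) * s i ≤ OPT * ((1 + α) / (1 - α)) := by
      calc ∑ i, (p i : ℝ) * s i = ∑ j, ∑ i with f i = j, (p i : ℝ) * s i :=
            (Finset.sum_fiberwise _ _ _).symm
        _ ≤ ∑ _j : Fin OPT, (1 + α) / (1 - α) := by
            refine Finset.sum_le_sum fun j _ => ?_
            have h1 := StochPack.sum_integral_le (fun i => (hlaw i).aemeasurable)
              (fun i => StochPack.hasLaw_bernoulli_mem_Icc (hs i).le ((hs' i).trans hsmax) (hlaw i))
              hindep (Finset.univ.filter fun i => f i = j) (by linarith) (hf j)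
            simpa only [StochPack.hasLaw_bernoulli_integral (hlaw _)] using h1
        _ = _ := by simp
    have h1 := hloads ((StochPack.groups smax smin).filter fun g => 2 ≤ (st g).length)
      fun g hg => (Finset.mem_filter.1 hg).2
    have h2 := hrun.sum_le (v := fun i => (p i : ℝ) * s i)
      (fun i => mul_nonneg (p i).2.1 (hs i).le)
      ((StochPack.groups smax smin).filter fun g => 2 ≤ (st g).length)
    rw [← List.ofFn_eq_map, List.sum_ofFn] at h2
    have h3 : ∑ g ∈ StochPack.groups smax smin with 2 ≤ (st g).length, ((st g).length : ℝ) ≤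
        StochPack.approxConst α smax smin pmax * OPT := by
      have e : StochPack.approxConst α smax smin pmax * OPT =
          OPT * ((1 + α) / (1 - α)) / StochPack.muMin α smax smin pmax := by
        rw [StochPack.approxConst]; field_simp
      rw [e, le_div_iff₀ hmu, mul_comm]
      exact h1.trans (h2.trans htotal)
    have h4 := StochPack.binCount_le hsmin hsmin' st
    linarith
  · rw [div_lt_one (by positivity)]; linarith
  · rw [StochPack.approxConst_eq]
    have h1 := one_div_le_one_div_of_le (by positivity)
      (StochPack.two_mul_muMin_le (smax := smax) (smin := smin) (pmax := pmax) hα hα')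
    rw [one_div_div] at h1
    exact mul_le_mul_of_nonneg_left h1 (by positivity)
  · have hC : StochPack.approxConst α smax smin pmax =
        2 * ((1 + α) / (1 - α)) *
          ((1 + StochPack.lamMin α smax) / StochPack.lamMin α smax) := by
      rw [StochPack.approxConst_eq, StochPack.two_mul_muMin_eq hα hα' hsmin hpmax hpmax' h h',
        one_div_div]
    refine ⟨hC, fun h1 => ?_⟩
    have hq : 0 < StochPack.poissonQInv 2 (1 - α) :=
      StochPack.poissonQInv_pos 1 (by linarith) (by linarith)
    have hl : StochPack.lamMin α smax = StochPack.poissonQInv 2 (1 - α) / 2 := by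
      rw [h1, StochPack.lamMin]; norm_num
    rw [hC, hl]
    congr 1
    field_simp
    ring
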